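/- **Theorem 3.1.** Let $T>0$, let $(\Omega,\mathcal F,(\mathcal F_t)_{0\le t\le T},\mathbb P)$ be a filtered probability space satisfying the usual conditions, and let $K,H$ be real separable Hilbert spaces. Let $W$ be a $K$-valued Wiener process with covariance operator $Q$, and let $\mu$ be a Poisson random measure on $[0,T]\times Z$ with compensator $\mathrm{Leb}\otimes m$, where $(Z,\mathcal Z,m)$ is a $\sigma$-finite measure space; put $\bar\mu:=\mu-\mathrm{Leb}\otimes m$. Both noises are understood relative to the given filtration. Write $|\Phi|_Q$ for the Hilbert–Schmidt norm of a linear operator $\Phi:Q^{1/2}K\to H$, where $Q^{1/2}K$ carries the inner product transported by $Q^{1/2}$, and $|\cdot|_m$ for the norm of $L^2(Z,m;H)$. Consider $$du(t)+Au(t)\,dt+Fu(t)\,dt=B(t)\,dW(t)+\int_Z G(t,z)\,\bar\mu(dt,dz),\qquad u(0)=u_0, \tag{1}$$ where * $A$ is a linear monotone operator on $H$ such that $-A$ generates a strongly continuous semigroup $(e^{-tA})_{t\ge0}$; * $F:\mathrm{dom}(F)\subset H\to H$ is a (nonlinear) operator such that $x\mapsto Fx+\eta x$ is monotone on $\mathrm{dom}(F)$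 for some $\eta\in\mathbb R$; * $B$ is a progressively measurable process whose values are linear operators $Q^{1/2}K\to H$ (progressive measurability of $B(\cdot)Q^{1/2}k$ for each $k\in K$), and $G:[0,T]\times\Omega\times Z\to H$ is $\mathcal P\otimes\mathcal Z$-measurable, $\mathcal P$ being the predictable $\sigma$-field; * for every $t\le T$, $\mathbb P$-a.s., $$\int_0^t\Big(\big|e^{-(t-s)A}B(s)\big|_Q^2+\big|e^{-(t-s)A}G(s,\cdot)\big|_m^2\Big)\,ds<\infty ,$$ with $|e^{-(t-s)A}B(s)|_Q<\infty$ for a.e. $s\in[0,t]$. A *mild solution* of (1) is an adapted, jointly measurable $H$-valued process $u$ on $[0,T]$ such that, $\mathbb P$-a.s., $u(s)\in\mathrm{dom}(F)$ for a.e. $s\in[0,T]$ and, for every $t\le T$, $\mathbb P$-a.s., $$u(t)+\int_0^t e^{-(t-s)A}Fu(s)\,ds=e^{-tA}u_0+\int_0^t e^{-(t-s)A}B(s)\,dW(s)+\int_0^t\!\int_Z e^{-(t-s)A}G(s,z)\,\bar\mu(ds,dz),$$ all integrals being well-defined. Then (1) has at most one mild solution with $Fu\in L^1([0,T];H)$ $\mathbb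 P$-a.s.: if $u$ and $v$ are two such solutions with the same initial condition $u_0$, then $u(t)=v(t)$ $\mathbb P$-a.s. for every $t\le T$. If, moreover, outside a single $\mathbb P$-null set the mild equations of $u$ and $v$ hold for all $t\le T$ simultaneously, with a common version of the right-hand side, then $\mathbb P$-a.s. $u(t)=v(t)$ for all $t\le T$. -/

import Mathlib

open MeasureTheory ProbabilityTheory Filter Topology
open scoped NNReal ENNReal RealInnerProductSpace

noncomputable section

namespace MildEq

/-! Time runs through `ℝ≥0`; all processes, the Wiener process and the Poisson measure are only
used on `[0, T] = Set.Iic T`. -/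

/-- Lebesgue measure on the half-line `[0, ∞)`. -/
def leb : Measure ℝ≥0 := Measure.comap ((↑) : ℝ≥0 → ℝ) volume

/-! ### The linear operator and its semigroup -/

/-- `S` is the strongly continuous semigroup `e^{-tA}` on `H`: it is a `C₀`-semigroup, and its
infinitesimal generator, with the generator's full domain, is `-A`. -/
structure IsSemigroupOf {H : Type*} [NormedAddCommGroup H] [NormedSpace ℝ H]
    (S : ℝ≥0 → H →L[ℝ] H) (A : H →ₗ.[ℝ] H) : Prop where
  zero : S 0 = ContinuousLinearMap.id ℝ H
  add : ∀ s t, S (s + t) = (S s).comp (S t)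
  continuous : ∀ x, Continuous fun t => S t x
  generator : ∀ x y, (x, y) ∈ A.graph ↔
    Tendsto (fun h : ℝ≥0 => (h : ℝ)⁻¹ • (S h x - x)) (𝓝[>] 0) (𝓝 (-y))

/-! ### Hilbert–Schmidt norms -/

/-- The squared Hilbert–Schmidt norm of a linear map, as the supremum of `∑ ‖T eᵢ‖²` over finite
orthonormal families; it is infinite if `T` is not Hilbert–Schmidt, in particular if `T` is
unbounded. -/
def hsNormSq {K H : Type*} [NormedAddCommGroup K] [InnerProductSpace ℝ K]
    [NormedAddCommGroup H] [InnerProductSpace ℝ H] (T : K →ₗ[ℝ] H) : ℝ≥0∞ :=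
  ⨆ (n : ℕ) (e : Fin n → K) (_ : Orthonormal ℝ e), ∑ i, ‖T (e i)‖ₑ ^ 2

/-- `|Φ|_Q²`, for a linear map `Φ` on `Q^{1/2} K` (here `R = Q^{1/2}`): the squared
Hilbert–Schmidt norm of `Φ Q^{1/2}` on `K`. This is the squared Hilbert–Schmidt norm of `Φ` on
`Q^{1/2} K` with the inner product transported by `Q^{1/2}`. -/
def qNormSq {K H : Type*} [NormedAddCommGroup K] [InnerProductSpace ℝ K]
    [NormedAddCommGroup H] [InnerProductSpace ℝ H] (R : K →L[ℝ] K)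
    (Φ : R.toLinearMap.range →ₗ[ℝ] H) : ℝ≥0∞ :=
  hsNormSq (Φ ∘ₗ R.toLinearMap.rangeRestrict)

/-! ### The stochastic basis and the driving noises -/

/-- The usual conditions on `[0, T]`: right-continuity, and `𝓕 0` contains all null sets. -/
structure UsualConditions {Ω : Type*} [mΩ : MeasurableSpace Ω] (P : Measure Ω)
    (𝓕 : Filtration ℝ≥0 mΩ) (T : ℝ≥0) : Prop where
  right_cont : ∀ t < T, (⨅ s ∈ Set.Ioi t, 𝓕 s) ≤ 𝓕 t
  null_sets : ∀ N : Set Ω, P N = 0 → MeasurableSet[𝓕 0] N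

/-- `W` is a `K`-valued Wiener process on `[0, T]` relative to `𝓕`, with covariance operator
`Q`. -/
structure IsWienerProc {Ω : Type*} [mΩ : MeasurableSpace Ω] (P : Measure Ω)
    (𝓕 : Filtration ℝ≥0 mΩ) (T : ℝ≥0) {K : Type*} [NormedAddCommGroup K] [InnerProductSpace ℝ K]
    (Q : K →L[ℝ] K) (W : ℝ≥0 → Ω → K) : Prop where
  adapted : ∀ t ≤ T, StronglyMeasurable[𝓕 t] (W t)
  zero : ∀ᵐ ω ∂P, W 0 ω = 0
  continuous : ∀ᵐ ω ∂P, ContinuousOn (fun t => W t ω) (Set.Iic T)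
  indep : ∀ s t, s ≤ t → t ≤ T →
    Indep (MeasurableSpace.comap (fun ω => W t ω - W s ω) (borel K)) (𝓕 s) P
  gaussian : ∀ s t, s ≤ t → t ≤ T → ∀ k : K,
    P.map (fun ω => ⟪W t ω - W s ω, k⟫) =
      gaussianReal 0 (Real.toNNReal (((t : ℝ) - s) * ⟪Q k, k⟫))

/-- `μ` is a Poisson random measure on `[0, T] × Z` relative to `𝓕`, with compensator
`Leb ⊗ m`. -/
structure IsPoissonRandomMeasure {Ω : Type*} [mΩ : MeasurableSpace Ω] (P : Measure Ω)
    (𝓕 : Filtration ℝ≥0 mΩ) (T : ℝ≥0) {Z : Type*} [MeasurableSpace Z] (m : Measure Z)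
    (μ : Ω → Measure (ℝ≥0 × Z)) : Prop where
  integer_valued : ∀ᵐ ω ∂P, ∀ E, MeasurableSet E → E ⊆ Set.Iic T ×ˢ Set.univ →
    ∃ n : ℕ∞, μ ω E = (n : ℝ≥0∞)
  adapted : ∀ t ≤ T, ∀ E, MeasurableSet E → E ⊆ Set.Iic t ×ˢ Set.univ →
    Measurable[𝓕 t] fun ω => μ ω E
  law : ∀ E, MeasurableSet E → E ⊆ Set.Iic T ×ˢ Set.univ → (leb.prod m) E ≠ ∞ →
    P.map (fun ω => μ ω E) =
      (poissonMeasure ((leb.prod m) E).toNNReal).map (fun n : ℕ => (n : ℝ≥0∞))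
  indep_disjoint : ∀ (n : ℕ) (E : Fin n → Set (ℝ≥0 × Z)),
    (∀ i, MeasurableSet (E i)) → (∀ i, E i ⊆ Set.Iic T ×ˢ Set.univ) →
    Pairwise (fun i j => Disjoint (E i) (E j)) → iIndepFun (fun i ω => μ ω (E i)) P
  indep_past : ∀ t ≤ T,
    Indep (⨆ E ∈ {E : Set (ℝ≥0 × Z) | MeasurableSet E ∧ E ⊆ Set.Ioc t T ×ˢ Set.univ},
      MeasurableSpace.comap (fun ω => μ ω E) inferInstance) (𝓕 t) P

/-! ### The stochastic integral with respect to the Wiener process -/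

/-- A simple integrand `∑ᵢ 1_{(sᵢ, tᵢ]}(r) 1_{Aᵢ}(ω) Lᵢ` with `Aᵢ ∈ 𝓕 sᵢ` and
`Lᵢ ∈ 𝓛(K → H)`. -/
structure SimpleW {Ω : Type*} [mΩ : MeasurableSpace Ω] (𝓕 : Filtration ℝ≥0 mΩ)
    (K H : Type*) [NormedAddCommGroup K] [InnerProductSpace ℝ K]
    [NormedAddCommGroup H] [InnerProductSpace ℝ H] where
  n : ℕ
  left : Fin n → ℝ≥0
  right : Fin n → ℝ≥0
  left_le_right : ∀ i, left i ≤ right i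
  event : Fin n → Set Ω
  measurable_event : ∀ i, MeasurableSet[𝓕 (left i)] (event i)
  op : Fin n → K →L[ℝ] H

/-- The value of a simple integrand at `(r, ω)`. -/
def SimpleW.eval {Ω : Type*} [mΩ : MeasurableSpace Ω] {𝓕 : Filtration ℝ≥0 mΩ}
    {K H : Type*} [NormedAddCommGroup K] [InnerProductSpace ℝ K]
    [NormedAddCommGroup H] [InnerProductSpace ℝ H] (φ : SimpleW 𝓕 K H) (r : ℝ≥0) (ω : Ω) :
    K →L[ℝ] H :=
  ∑ i, (Set.Ioc (φ.left i) (φ.right i) ×ˢ φ.event i).indicator (fun _ => φ.op i) (r, ω)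

/-- The stochastic integral of a simple integrand over `(0, t]`. -/
def SimpleW.integral {Ω : Type*} [mΩ : MeasurableSpace Ω] {𝓕 : Filtration ℝ≥0 mΩ}
    {K H : Type*} [NormedAddCommGroup K] [InnerProductSpace ℝ K]
    [NormedAddCommGroup H] [InnerProductSpace ℝ H] (φ : SimpleW 𝓕 K H) (W : ℝ≥0 → Ω → K)
    (t : ℝ≥0) (ω : Ω) : H :=
  ∑ i, (φ.event i).indicator
    (fun ω => φ.op i (W (min (φ.right i) t) ω - W (min (φ.left i) t) ω)) ω

/-- The simple integrands `φ n` approximate `Φ` on `[0, t]`: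
`∫₀ᵗ |φ n - Φ|_Q² ds → 0` in probability. -/
def ApproxW {Ω : Type*} [mΩ : MeasurableSpace Ω] (P : Measure Ω) {𝓕 : Filtration ℝ≥0 mΩ}
    {K H : Type*} [NormedAddCommGroup K] [InnerProductSpace ℝ K]
    [NormedAddCommGroup H] [InnerProductSpace ℝ H] (R : K →L[ℝ] K)
    (Φ : ℝ≥0 → Ω → R.toLinearMap.range →ₗ[ℝ] H) (t : ℝ≥0) (φ : ℕ → SimpleW 𝓕 K H) : Prop :=
  ∀ ε : ℝ≥0∞, 0 < ε → Tendsto (fun n => P {ω | ε ≤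
    ∫⁻ s in Set.Iic t, qNormSq R
      (((φ n).eval s ω).toLinearMap.domRestrict R.toLinearMap.range - Φ s ω) ∂leb})
    atTop (𝓝 0)

/-- `X` is (a version of) the stochastic integral `∫₀ᵗ Φ(s) dW(s)`, where `R = Q^{1/2}`: the
integral of simple integrands is extended by continuity, that is, approximating sequences of
simple integrands exist and the integrals of each of them converge to `X` in probability. Such
an `X` is unique up to almost sure equality. -/
def IsWienerIntegral {Ω : Type*} [mΩ : MeasurableSpace Ω] (P : Measure Ω)
    (𝓕 : Filtration ℝ≥0 mΩ) {K H : Type*} [NormedAddCommGroup K] [InnerProductSpace ℝ K]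
    [NormedAddCommGroup H] [InnerProductSpace ℝ H] (R : K →L[ℝ] K) (W : ℝ≥0 → Ω → K)
    (Φ : ℝ≥0 → Ω → R.toLinearMap.range →ₗ[ℝ] H) (t : ℝ≥0) (X : Ω → H) : Prop :=
  (∃ φ : ℕ → SimpleW 𝓕 K H, ApproxW P R Φ t φ) ∧
  ∀ φ : ℕ → SimpleW 𝓕 K H, ApproxW P R Φ t φ →
    TendstoInMeasure P (fun n => (φ n).integral W t) atTop X

/-! ### The stochastic integral with respect to the compensated Poisson measure -/

/-- A simple integrand `∑ᵢ 1_{(sᵢ, tᵢ]}(r) 1_{Aᵢ}(ω) 1_{Eᵢ}(z) xᵢ` with `Aᵢ ∈ 𝓕 sᵢ`,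
`m(Eᵢ) < ∞` and `xᵢ ∈ H`. -/
structure SimpleM {Ω : Type*} [mΩ : MeasurableSpace Ω] (𝓕 : Filtration ℝ≥0 mΩ)
    {Z : Type*} [MeasurableSpace Z] (m : Measure Z) (H : Type*) where
  n : ℕ
  left : Fin n → ℝ≥0
  right : Fin n → ℝ≥0
  left_le_right : ∀ i, left i ≤ right i
  event : Fin n → Set Ω
  measurable_event : ∀ i, MeasurableSet[𝓕 (left i)] (event i)
  mark : Fin n → Set Z
  measurable_mark : ∀ i, MeasurableSet (mark i)
  finite_mark : ∀ i, m (mark i) ≠ ∞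
  vec : Fin n → H

/-- The value of a simple integrand at `(r, ω, z)`. -/
def SimpleM.eval {Ω : Type*} [mΩ : MeasurableSpace Ω] {𝓕 : Filtration ℝ≥0 mΩ}
    {Z : Type*} [MeasurableSpace Z] {m : Measure Z} {H : Type*} [NormedAddCommGroup H]
    (φ : SimpleM 𝓕 m H) (r : ℝ≥0) (ω : Ω) (z : Z) : H :=
  ∑ i, (Set.Ioc (φ.left i) (φ.right i) ×ˢ φ.event i ×ˢ φ.mark i).indicator
    (fun _ => φ.vec i) (r, ω, z)

/-- The integral of a simple integrand over `(0, t] × Z` with respect to `μ - Leb ⊗ m`. -/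
def SimpleM.integral {Ω : Type*} [mΩ : MeasurableSpace Ω] {𝓕 : Filtration ℝ≥0 mΩ}
    {Z : Type*} [MeasurableSpace Z] {m : Measure Z} {H : Type*} [NormedAddCommGroup H]
    [NormedSpace ℝ H] (φ : SimpleM 𝓕 m H) (μ : Ω → Measure (ℝ≥0 × Z)) (t : ℝ≥0) (ω : Ω) : H :=
  ∑ i, (φ.event i).indicator (fun ω =>
    ((μ ω (Set.Ioc (min (φ.left i) t) (min (φ.right i) t) ×ˢ φ.mark i)).toReal
      - ((leb.prod m) (Set.Ioc (min (φ.left i) t) (min (φ.right i) t) ×ˢ φ.mark i)).toReal)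
      • φ.vec i) ω

/-- The simple integrands `φ n` approximate `g` on `[0, t] × Z`:
`∫₀ᵗ ∫_Z |φ n - g|² m(dz) ds → 0` in probability. -/
def ApproxM {Ω : Type*} [mΩ : MeasurableSpace Ω] (P : Measure Ω) {𝓕 : Filtration ℝ≥0 mΩ}
    {Z : Type*} [MeasurableSpace Z] {m : Measure Z} {H : Type*} [NormedAddCommGroup H]
    (g : ℝ≥0 → Ω → Z → H) (t : ℝ≥0) (φ : ℕ → SimpleM 𝓕 m H) : Prop :=
  ∀ ε : ℝ≥0∞, 0 < ε → Tendsto (fun n => P {ω | ε ≤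
    ∫⁻ s in Set.Iic t, ∫⁻ z, ‖(φ n).eval s ω z - g s ω z‖ₑ ^ 2 ∂m ∂leb}) atTop (𝓝 0)

/-- `X` is (a version of) the stochastic integral `∫₀ᵗ ∫_Z g(s, z) μ̄(ds, dz)` with
`μ̄ = μ - Leb ⊗ m`, again by continuous extension from simple integrands; unique up to almost
sure equality. -/
def IsPoissonIntegral {Ω : Type*} [mΩ : MeasurableSpace Ω] (P : Measure Ω)
    (𝓕 : Filtration ℝ≥0 mΩ) {Z : Type*} [MeasurableSpace Z] (m : Measure Z)
    (μ : Ω → Measure (ℝ≥0 × Z)) {H : Type*} [NormedAddCommGroup H] [NormedSpace ℝ H]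
    (g : ℝ≥0 → Ω → Z → H) (t : ℝ≥0) (X : Ω → H) : Prop :=
  (∃ φ : ℕ → SimpleM 𝓕 m H, ApproxM P g t φ) ∧
  ∀ φ : ℕ → SimpleM 𝓕 m H, ApproxM P g t φ →
    TendstoInMeasure P (fun n => (φ n).integral μ t) atTop X

/-! ### Mild solutions -/

/-- `u` is a mild solution on `[0, T]` of
`du + A u dt + F u dt = B dW + ∫_Z G(·, z) μ̄(dt, dz)`, `u(0) = u₀`, where `S t = e^{-tA}`,
`R = Q^{1/2}` and `D` is the domain of `F`: a measurable adapted process that satisfies, for every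
`t ≤ T`, almost surely,
`u(t) + ∫₀ᵗ S(t-s) F u(s) ds = S(t) u₀ + ∫₀ᵗ S(t-s) B(s) dW(s) + ∫₀ᵗ ∫_Z S(t-s) G(s, z) μ̄(ds, dz)`,
all the integrals being well-defined. -/
structure IsMildSolution {Ω : Type*} [mΩ : MeasurableSpace Ω] (P : Measure Ω)
    (𝓕 : Filtration ℝ≥0 mΩ) (T : ℝ≥0)
    {K H : Type*} [NormedAddCommGroup K] [InnerProductSpace ℝ K]
    [NormedAddCommGroup H] [InnerProductSpace ℝ H]
    (R : K →L[ℝ] K) (W : ℝ≥0 → Ω → K)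
    {Z : Type*} [MeasurableSpace Z] (m : Measure Z) (μ : Ω → Measure (ℝ≥0 × Z))
    (S : ℝ≥0 → H →L[ℝ] H) (D : Set H) (F : H → H)
    (B : ℝ≥0 → Ω → R.toLinearMap.range →ₗ[ℝ] H) (G : ℝ≥0 → Ω → Z → H)
    (u₀ : Ω → H) (u : ℝ≥0 → Ω → H) : Prop where
  adapted : ∀ t ≤ T, StronglyMeasurable[𝓕 t] (u t)
  measurable : StronglyMeasurable fun p : Set.Iic T × Ω => u p.1 p.2
  mem_domain : ∀ᵐ ω ∂P, ∀ᵐ s ∂(leb.restrict (Set.Iic T)), u s ω ∈ D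
  integrable : ∀ t ≤ T, ∀ᵐ ω ∂P,
    IntegrableOn (fun s => S (t - s) (F (u s ω))) (Set.Iic t) leb
  equation : ∀ t ≤ T, ∃ I J : Ω → H,
    IsWienerIntegral P 𝓕 R W (fun s ω => (S (t - s)).toLinearMap ∘ₗ B s ω) t I ∧
    IsPoissonIntegral P 𝓕 m μ (fun s ω z => S (t - s) (G s ω z)) t J ∧
    ∀ᵐ ω ∂P, u t ω + ∫ s in Set.Iic t, S (t - s) (F (u s ω)) ∂leb =
      S t (u₀ ω) + I ω + J ω

end MildEq

end

/-! Both solutions satisfy an equation with the same right-hand side, because a stochastic integral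
defined by extension from simple integrands is unique up to a null set: any one approximating
sequence converges in probability to both versions (`IsWienerIntegral.ae_eq`,
`IsPoissonIntegral.ae_eq`). So the noise cancels in `w = u - v`, and for each fixed `t`, almost surely,
`w(t) = y(t) := ∫₀ᵗ S(t-s) g(s) ds` with `g = F v - F u` (`IsMildSolution.ae_add_eq`). Since `y` has
continuous paths, Fubini's theorem upgrades this to: almost surely, `w = y` for almost every `t`
(`ae_ae_eq_of_continuous`).

The rest is pathwise. Monotonicity of `A` makes the semigroup contractive
(`IsSemigroupOf.norm_le`), and this gives the energy inequality `‖y(t)‖² ≤ 2 ∫₀ᵗ ⟪y, g⟫ ds`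
(`IsSemigroupOf.energy`). The inequality is proved directly for mild solutions, by a Dini derivative
if `g` is continuous and then by density in `L¹`, so that no regularization of `A` is needed. Finally
`⟪y, g⟫ = -⟪u - v, F u - F v⟫ ≤ η ‖y‖²` at almost every time, and Gronwall's lemma gives `y = 0` at
every time (`IsSemigroupOf.mildConv_eq_zero`). Hence `u(t) = v(t)` wherever `w(t) = y(t)`: almost
surely for each `t`, and at all times at once if the two equations hold at all times at once. -/

namespace MildEq

/-! ### Contractivity of the semigroup -/

section Semigroup

variable {H : Type*} [NormedAddCommGroup H] [InnerProductSpace ℝ H]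
  {S : ℝ≥0 → H →L[ℝ] H} {A : H →ₗ.[ℝ] H}

theorem IsSemigroupOf.continuous_toNNReal (hS : IsSemigroupOf S A) (x : H) :
    Continuous fun r : ℝ => S r.toNNReal x :=
  (hS.continuous x).comp continuous_real_toNNReal

theorem IsSemigroupOf.toNNReal_add (hS : IsSemigroupOf S A) {s t : ℝ} (hs : 0 ≤ s) (ht : 0 ≤ t)
    (x : H) : S (s + t).toNNReal x = S s.toNNReal (S t.toNNReal x) := by
  rw [Real.toNNReal_add hs ht, hS.add]; rfl

theorem tendsto_toNNReal_nhdsGT_zero :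
    Tendsto Real.toNNReal (𝓝[>] (0 : ℝ)) (𝓝[>] (0 : ℝ≥0)) := by
  refine tendsto_nhdsWithin_iff.2 ⟨?_, ?_⟩
  · simpa using (continuous_real_toNNReal.tendsto 0).mono_left nhdsWithin_le_nhds
  · filter_upwards [self_mem_nhdsWithin] with r hr
    simpa using hr

theorem tendsto_coe_nhdsGT_zero :
    Tendsto ((↑) : ℝ≥0 → ℝ) (𝓝[>] (0 : ℝ≥0)) (𝓝[>] (0 : ℝ)) := by
  refine tendsto_nhdsWithin_iff.2 ⟨?_, ?_⟩
  · simpa using (NNReal.continuous_coe.tendsto 0).mono_left nhdsWithin_le_nhds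
  · filter_upwards [self_mem_nhdsWithin] with r hr
    simpa using hr

theorem tendsto_sub_nhdsGT_zero (t : ℝ) :
    Tendsto (fun z : ℝ => z - t) (𝓝[>] t) (𝓝[>] 0) := by
  refine tendsto_nhdsWithin_iff.2 ⟨?_, ?_⟩
  · have : Tendsto (fun z : ℝ => z - t) (𝓝 t) (𝓝 (t - t)) := (continuous_sub_right t).tendsto t
    rw [sub_self] at this
    exact this.mono_left nhdsWithin_le_nhds
  · filter_upwards [self_mem_nhdsWithin] with r hr
    simpa using hr

/-- The orbit of a point of the domain of `A` solves `x' + A x = 0`, as a right derivative. -/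
theorem IsSemigroupOf.hasDerivWithinAt (hS : IsSemigroupOf S A) {x y : H}
    (hxy : (x, y) ∈ A.graph) {t : ℝ} (ht : 0 ≤ t) :
    HasDerivWithinAt (fun r : ℝ => S r.toNNReal x) (-S t.toNNReal y) (Set.Ici t) t := by
  rw [← hasDerivWithinAt_Ioi_iff_Ici, hasDerivWithinAt_iff_tendsto_slope' (by simp)]
  have h1 := ((hS.generator x y).1 hxy).comp tendsto_toNNReal_nhdsGT_zero
  have h2 := ((S t.toNNReal).continuous.tendsto (-y)).comp h1
  have h3 := tendsto_sub_nhdsGT_zero t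
  rw [map_neg] at h2
  refine (h2.comp h3).congr' ?_
  filter_upwards [self_mem_nhdsWithin] with z hz
  have hz' : 0 ≤ z - t := sub_nonneg.2 (le_of_lt hz)
  have h4 := hS.toNNReal_add ht hz' x
  rw [add_sub_cancel] at h4
  simp only [Function.comp_apply, slope_def_module, map_smul, map_sub, Real.coe_toNNReal _ hz', h4]

theorem IsSemigroupOf.mem_graph (hS : IsSemigroupOf S A) {x y : H}
    (hxy : (x, y) ∈ A.graph) (t : ℝ≥0) : (S t x, S t y) ∈ A.graph := by
  rw [hS.generator]
  have h2 := ((S t).continuous.tendsto (-y)).comp ((hS.generator x y).1 hxy)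
  rw [map_neg] at h2
  refine h2.congr fun h => ?_
  have h5 : S h (S t x) = S t (S h x) := by
    have h3 := congrArg (fun L => L x) (hS.add t h)
    have h4 := congrArg (fun L => L x) (hS.add h t)
    rw [add_comm] at h4
    exact h4.symm.trans h3
  simp only [Function.comp_apply, map_smul, map_sub, h5]

/-- The averages `h⁻¹ ∫₀ʰ S r x dr` of an orbit lie in the domain of the generator and tend
to `x`. -/
theorem IsSemigroupOf.dense_domain [CompleteSpace H] (hS : IsSemigroupOf S A) :
    Dense {x : H | ∃ y, (x, y) ∈ A.graph} := by
  intro x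
  set V : ℝ → H := fun r => S r.toNNReal x with hV
  have hVc : Continuous V := hS.continuous_toNNReal x
  have hV0 : V 0 = x := by simp [hV, hS.zero]
  have hder : ∀ b : ℝ, HasDerivAt (fun u => ∫ r in (0 : ℝ)..u, V r) (V b) b := fun b =>
    (hVc.integral_hasStrictDerivAt 0 b).hasDerivAt
  have hint : ∀ a b : ℝ, IntervalIntegrable V volume a b := fun a b => hVc.intervalIntegrable a b
  have hmem : ∀ h : ℝ, 0 < h →
      (∫ r in (0 : ℝ)..h, V r, -(V h - x)) ∈ A.graph := by
    intro h hh
    rw [hS.generator, neg_neg]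
    have h1 : HasDerivAt (fun e : ℝ => (∫ r in (0 : ℝ)..(h + e), V r) - ∫ r in (0 : ℝ)..e, V r)
        (V h - x) 0 := by
      have h2 : HasDerivAt (fun e : ℝ => ∫ r in (0 : ℝ)..(h + e), V r) (V h) 0 := by
        have := (hder (h + 0)).comp_const_add h 0
        simpa using this
      have h3 := hder 0
      rw [hV0] at h3
      exact h2.sub h3
    have h4 := (hasDerivWithinAt_iff_tendsto_slope' (s := Set.Ioi 0) (by simp)).1
      h1.hasDerivWithinAt
    refine (h4.comp tendsto_coe_nhdsGT_zero).congr' ?_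
    filter_upwards with e
    have h5 : S e (∫ r in (0 : ℝ)..h, V r) = ∫ r in (e : ℝ)..(h + e), V r := by
      rw [← ContinuousLinearMap.intervalIntegral_comp_comm _ (hint 0 h)]
      have h6 : ∫ r in (0 : ℝ)..h, V (r + e) = ∫ r in (e : ℝ)..(h + e), V r := by simp
      rw [← h6]
      refine intervalIntegral.integral_congr fun r hr => ?_
      rw [Set.uIcc_of_le hh.le] at hr
      have := hS.toNNReal_add e.2 hr.1 x
      rw [add_comm] at this
      simpa [hV] using this.symm
    have h7 : (∫ r in (0 : ℝ)..(h + e), V r) - ∫ r in (0 : ℝ)..e, V r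
        = ∫ r in (e : ℝ)..(h + e), V r := by
      rw [sub_eq_iff_eq_add']
      exact (intervalIntegral.integral_add_adjacent_intervals (hint _ _) (hint _ _)).symm
    simp [slope_def_module, h5, h7]
  have hlim : Tendsto (fun h : ℝ => h⁻¹ • ∫ r in (0 : ℝ)..h, V r) (𝓝[>] 0) (𝓝 x) := by
    have h1 := (hasDerivWithinAt_iff_tendsto_slope' (s := Set.Ioi 0) (by simp)).1
      (hder 0).hasDerivWithinAt
    rw [hV0] at h1
    refine h1.congr fun h => ?_
    simp [slope_def_module]
  refine mem_closure_of_tendsto hlim ?_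
  filter_upwards [self_mem_nhdsWithin] with h hh
  exact ⟨h⁻¹ • -(V h - x), A.graph.smul_mem h⁻¹ (hmem h hh)⟩

/-- Monotonicity of `A` makes `t ↦ ‖S t x‖²` nonincreasing for `x` in the dense domain of `A`. -/
theorem IsSemigroupOf.norm_le [CompleteSpace H] (hS : IsSemigroupOf S A)
    (hA : ∀ x : A.domain, 0 ≤ ⟪A x, (x : H)⟫) (t : ℝ≥0) (x : H) : ‖S t x‖ ≤ ‖x‖ := by
  have hmon : ∀ x y : H, (x, y) ∈ A.graph → 0 ≤ ⟪x, y⟫ := by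
    intro x y hxy
    obtain ⟨z, hz, hz'⟩ := (LinearPMap.mem_graph_iff A).1 hxy
    dsimp only at hz hz'
    rw [← hz, ← hz', real_inner_comm]
    exact hA z
  have hclosed : IsClosed {x : H | ‖S t x‖ ≤ ‖x‖} :=
    isClosed_le (S t).continuous.norm continuous_norm
  refine hclosed.closure_subset_iff.2 ?_ (hS.dense_domain x)
  rintro x ⟨y, hxy⟩
  have h := image_le_of_deriv_right_le_deriv_boundary (a := 0) (b := t)
    (f := fun r : ℝ => ‖S r.toNNReal x‖ ^ 2) (B := fun _ => ‖x‖ ^ 2) (B' := fun _ => 0)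
    (f' := fun r : ℝ => 2 * ⟪S r.toNNReal x, -S r.toNNReal y⟫)
    ((hS.continuous_toNNReal x).norm.pow 2).continuousOn
    (fun r hr => (hS.hasDerivWithinAt hxy hr.1).norm_sq)
    (by simp [hS.zero]) continuousOn_const (fun _ _ => hasDerivWithinAt_const _ _ _)
    (fun r _ => by
      have := hmon _ _ (hS.mem_graph hxy r.toNNReal)
      rw [inner_neg_right]; linarith)
    (Set.right_mem_Icc.2 t.2)
  simp only [Real.toNNReal_coe] at h
  exact (sq_le_sq₀ (norm_nonneg _) (norm_nonneg _)).1 h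

/-- Strong continuity and contractivity together give joint continuity. -/
theorem IsSemigroupOf.continuous_uncurry (hS : IsSemigroupOf S A)
    (hc : ∀ t x, ‖S t x‖ ≤ ‖x‖) :
    Continuous (Function.uncurry fun (r : ℝ) (x : H) => S r.toNNReal x) := by
  refine continuous_iff_continuousAt.2 fun ⟨r, x⟩ => ?_
  rw [ContinuousAt, tendsto_iff_norm_sub_tendsto_zero]
  have h : Tendsto (fun p : ℝ × H => ‖p.2 - x‖ + ‖S p.1.toNNReal x - S r.toNNReal x‖)
      (𝓝 (r, x)) (𝓝 0) := by
    have h1 : Continuous fun p : ℝ × H => ‖p.2 - x‖ + ‖S p.1.toNNReal x - S r.toNNReal x‖ :=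
      (continuous_snd.sub continuous_const).norm.add
        (((hS.continuous_toNNReal x).comp continuous_fst).sub continuous_const).norm
    simpa using h1.tendsto (r, x)
  refine squeeze_zero (fun _ => norm_nonneg _) (fun p => ?_) h
  calc ‖S p.1.toNNReal p.2 - S r.toNNReal x‖
      = ‖S p.1.toNNReal (p.2 - x) + (S p.1.toNNReal x - S r.toNNReal x)‖ := by
        rw [map_sub]; congr 1; abel
    _ ≤ _ := (norm_add_le _ _).trans (by gcongr; exact hc _ _)

end Semigroup

/-! ### Convolution with the semigroup and the energy inequality -/

section Convolution

variable {H : Type*} [NormedAddCommGroup H] [InnerProductSpace ℝ H]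
  {S : ℝ≥0 → H →L[ℝ] H} {A : H →ₗ.[ℝ] H} {f g : ℝ → H}

/-- The convolution `t ↦ ∫₀ᵗ S(t-s) g(s) ds`, the mild solution of `y' + A y = g`, `y 0 = 0`.
Time is real; only `t ≥ 0` is meaningful,
and then `t - s ≥ 0` on the range of integration, so that `toNNReal` loses nothing. -/
noncomputable def mildConv (S : ℝ≥0 → H →L[ℝ] H) (g : ℝ → H) (t : ℝ) : H :=
  ∫ s in (0 : ℝ)..t, S (t - s).toNNReal (g s)

@[simp]
theorem mildConv_zero (S : ℝ≥0 → H →L[ℝ] H) (g : ℝ → H) : mildConv S g 0 = 0 := by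
  simp [mildConv]

theorem IsSemigroupOf.aestronglyMeasurable (hS : IsSemigroupOf S A)
    (hc : ∀ t x, ‖S t x‖ ≤ ‖x‖) {ν : Measure ℝ} (hg : AEStronglyMeasurable g ν) (t : ℝ) :
    AEStronglyMeasurable (fun s => S (t - s).toNNReal (g s)) ν :=
  (hS.continuous_uncurry hc).comp_aestronglyMeasurable₂
    (continuous_sub_left t).aestronglyMeasurable hg

theorem IsSemigroupOf.integrable (hS : IsSemigroupOf S A)
    (hc : ∀ t x, ‖S t x‖ ≤ ‖x‖) {ν : Measure ℝ} (hg : Integrable g ν) (t : ℝ) :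
    Integrable (fun s => S (t - s).toNNReal (g s)) ν :=
  hg.mono (hS.aestronglyMeasurable hc hg.1 t) (Eventually.of_forall fun _ => hc _ _)

theorem norm_mildConv_le (hc : ∀ t x, ‖S t x‖ ≤ ‖x‖) (hg : Integrable g) (t : ℝ) :
    ‖mildConv S g t‖ ≤ ∫ s, ‖g s‖ := by
  refine intervalIntegral.norm_integral_le_integral_norm_uIoc.trans ?_
  calc ∫ s in Set.uIoc 0 t, ‖S (t - s).toNNReal (g s)‖
      ≤ ∫ s in Set.uIoc 0 t, ‖g s‖ :=
        integral_mono_of_nonneg (Eventually.of_forall fun _ => norm_nonneg _)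
          hg.norm.integrableOn (Eventually.of_forall fun _ => hc _ _)
    _ ≤ _ := setIntegral_le_integral hg.norm (Eventually.of_forall fun _ => norm_nonneg _)

theorem IsSemigroupOf.mildConv_sub (hS : IsSemigroupOf S A) (hc : ∀ t x, ‖S t x‖ ≤ ‖x‖)
    (hf : Integrable f) (hg : Integrable g) (t : ℝ) :
    mildConv S (fun s => f s - g s) t = mildConv S f t - mildConv S g t := by
  simp only [mildConv, map_sub]
  exact intervalIntegral.integral_sub (hS.integrable hc hf t).intervalIntegrable
    (hS.integrable hc hg t).intervalIntegrable

theorem IsSemigroupOf.continuous_mildConv (hS : IsSemigroupOf S A)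
    (hc : ∀ t x, ‖S t x‖ ≤ ‖x‖) (hg : Integrable g) : Continuous (mildConv S g) := by
  refine continuous_iff_continuousAt.2 fun t => ?_
  have h := intervalIntegral.continuousAt_parametric_primitive_of_dominated (μ := volume)
    (F := fun (r : ℝ) (s : ℝ) => S (r - s).toNNReal (g s)) (fun s => ‖g s‖)
    (min 0 t - 1) (max 0 t + 1) (a₀ := 0) (b₀ := t) (x₀ := t)
    (fun r => hS.aestronglyMeasurable hc hg.1.restrict r)
    (Eventually.of_forall fun r => Eventually.of_forall fun s => hc _ _)
    hg.norm.intervalIntegrable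
    (Eventually.of_forall fun s =>
      ((hS.continuous_toNNReal (g s)).comp (continuous_sub_right s)).continuousAt)
    ⟨by linarith [min_le_left 0 t], by linarith [le_max_left 0 t]⟩
    ⟨by linarith [min_le_right 0 t], by linarith [le_max_right 0 t]⟩ (by simp)
  exact h.comp₂ (f := fun p => ∫ s in (0 : ℝ)..p.2, S (p.1 - s).toNNReal (g s))
    continuousAt_id continuousAt_id

theorem IsSemigroupOf.mildConv_add [CompleteSpace H] (hS : IsSemigroupOf S A)
    (hc : ∀ t x, ‖S t x‖ ≤ ‖x‖) (hg : Integrable g) {t h : ℝ} (ht : 0 ≤ t) (hh : 0 ≤ h) :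
    mildConv S g (t + h) =
      S h.toNNReal (mildConv S g t) + ∫ s in t..(t + h), S (t + h - s).toNNReal (g s) := by
  have h1 : S h.toNNReal (mildConv S g t) = ∫ s in (0 : ℝ)..t, S (t + h - s).toNNReal (g s) := by
    rw [mildConv, ← ContinuousLinearMap.intervalIntegral_comp_comm _
      (hS.integrable hc hg t).intervalIntegrable]
    refine intervalIntegral.integral_congr fun s hs => ?_
    rw [Set.uIcc_of_le ht] at hs
    have := hS.toNNReal_add hh (sub_nonneg.2 hs.2) (g s)
    rw [← this]
    congr 3; ring
  rw [h1, mildConv, intervalIntegral.integral_add_adjacent_intervals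
    (hS.integrable hc hg _).intervalIntegrable (hS.integrable hc hg _).intervalIntegrable]

/-- The normalized increment of the convolution with a continuous function. -/
theorem IsSemigroupOf.tendsto_average [CompleteSpace H] (hS : IsSemigroupOf S A)
    (hc : ∀ t x, ‖S t x‖ ≤ ‖x‖) (hg : Integrable g) (hgc : Continuous g) (t : ℝ) :
    Tendsto (fun h : ℝ => h⁻¹ • ∫ s in t..(t + h), S (t + h - s).toNNReal (g s))
      (𝓝[>] 0) (𝓝 (g t)) := by
  rw [Metric.tendsto_nhds]
  intro ε hε
  have hcont : Continuous fun p : ℝ × ℝ => S p.1.toNNReal (g p.2) :=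
    (hS.continuous_uncurry hc).comp (continuous_fst.prodMk (hgc.comp continuous_snd))
  obtain ⟨δ, hδ, hδ'⟩ := Metric.continuousAt_iff.1 (hcont.continuousAt (x := (0, t))) (ε / 2)
    (half_pos hε)
  filter_upwards [Ioo_mem_nhdsGT hδ] with h hh
  have hh0 : 0 < h := hh.1
  have key : ‖∫ s in t..(t + h), (S (t + h - s).toNNReal (g s) - g t)‖
      ≤ ε / 2 * |t + h - t| := by
    refine intervalIntegral.norm_integral_le_of_norm_le_const fun s hs => ?_
    rw [Set.uIoc_of_le (by linarith)] at hs
    have h1 : dist ((t + h - s, s) : ℝ × ℝ) (0, t) < δ := by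
      rw [Prod.dist_eq]
      refine max_lt ?_ ?_
      · rw [Real.dist_eq, sub_zero, abs_of_nonneg (by linarith [hs.2])]
        linarith [hs.1, hh.2]
      · rw [Real.dist_eq, abs_of_nonneg (by linarith [hs.1])]
        linarith [hs.2, hh.2]
    have h2 := hδ' h1
    simp only [Real.toNNReal_zero, hS.zero, ContinuousLinearMap.id_apply] at h2
    rw [dist_eq_norm] at h2
    exact h2.le
  rw [intervalIntegral.integral_sub (hS.integrable hc hg _).intervalIntegrable
    (by simp), intervalIntegral.integral_const, add_sub_cancel_left, abs_of_pos hh0] at key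
  have h3 : h⁻¹ • (∫ s in t..(t + h), S (t + h - s).toNNReal (g s)) - g t
      = h⁻¹ • ((∫ s in t..(t + h), S (t + h - s).toNNReal (g s)) - h • g t) := by
    rw [smul_sub, inv_smul_smul₀ hh0.ne']
  rw [dist_eq_norm, h3, norm_smul, norm_inv, Real.norm_of_nonneg hh0.le]
  calc h⁻¹ * ‖(∫ s in t..(t + h), S (t + h - s).toNNReal (g s)) - h • g t‖
      ≤ h⁻¹ * (ε / 2 * h) := by gcongr
    _ = ε / 2 := by field_simp
    _ < ε := half_lt_self hε

/-- The energy inequality for a continuous right-hand side. By the flow property and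
contractivity, `‖y(t+h)‖² ≤ ‖y(t)‖² + 2 ⟪S h y(t), r⟫ + ‖r‖²` with `r = h g(t) + o(h)`, so the
upper right Dini derivative of `‖y‖²` is everywhere at most `2 ⟪y, g⟫`. -/
theorem IsSemigroupOf.energy_of_continuous [CompleteSpace H] (hS : IsSemigroupOf S A)
    (hc : ∀ t x, ‖S t x‖ ≤ ‖x‖) (hg : Integrable g) (hgc : Continuous g) {t : ℝ} (ht : 0 ≤ t) :
    ‖mildConv S g t‖ ^ 2 ≤ ∫ s in (0 : ℝ)..t, 2 * ⟪mildConv S g s, g s⟫ := by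
  have hy := hS.continuous_mildConv hc hg
  have hint : Continuous fun s => 2 * ⟪mildConv S g s, g s⟫ :=
    continuous_const.mul (hy.inner hgc)
  have hder : ∀ b, HasDerivAt (fun u => ∫ s in (0 : ℝ)..u, 2 * ⟪mildConv S g s, g s⟫)
      (2 * ⟪mildConv S g b, g b⟫) b := fun b => (hint.integral_hasStrictDerivAt 0 b).hasDerivAt
  refine image_le_of_liminf_slope_right_le_deriv_boundary (a := 0) (b := t)
    (f := fun s => ‖mildConv S g s‖ ^ 2)
    (B := fun u => ∫ s in (0 : ℝ)..u, 2 * ⟪mildConv S g s, g s⟫)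
    (B' := fun s => 2 * ⟪mildConv S g s, g s⟫)
    (hy.norm.pow 2).continuousOn (by simp)
    (fun b _ => (hder b).continuousAt.continuousWithinAt)
    (fun b _ => (hder b).hasDerivWithinAt) ?_ (Set.right_mem_Icc.2 ht)
  intro x hx r hr
  refine Eventually.frequently ?_
  set y := mildConv S g x with hyx
  set ρ : ℝ → H := fun h => ∫ s in x..(x + h), S (x + h - s).toNNReal (g s) with hρ
  have hav : Tendsto (fun h : ℝ => h⁻¹ • ρ h) (𝓝[>] 0) (𝓝 (g x)) :=
    hS.tendsto_average hc hg hgc x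
  have hid : Tendsto (fun h : ℝ => h) (𝓝[>] 0) (𝓝 0) := nhdsWithin_le_nhds
  have hSy : Tendsto (fun h : ℝ => S h.toNNReal y) (𝓝[>] 0) (𝓝 y) := by
    have := (hS.continuous_toNNReal y).tendsto 0
    simp only [Real.toNNReal_zero, hS.zero, ContinuousLinearMap.id_apply] at this
    exact this.mono_left nhdsWithin_le_nhds
  have hlim : Tendsto (fun h : ℝ => 2 * ⟪S h.toNNReal y, h⁻¹ • ρ h⟫ + h * ‖h⁻¹ • ρ h‖ ^ 2)
      (𝓝[>] 0) (𝓝 (2 * ⟪y, g x⟫)) := by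
    have := ((hSy.inner hav).const_mul 2).add (hid.mul (hav.norm.pow 2))
    simpa using this
  have hev := hlim.eventually_lt_const hr
  filter_upwards [(tendsto_sub_nhdsGT_zero x).eventually hev, self_mem_nhdsWithin] with z hz hxz
  refine lt_of_le_of_lt ?_ hz
  obtain ⟨h, rfl⟩ : ∃ h, z = x + h := ⟨z - x, by ring⟩
  have hh : 0 < h := by simpa using hxz
  rw [add_sub_cancel_left, slope_def_field, add_sub_cancel_left, div_le_iff₀ hh]
  have hflow : mildConv S g (x + h) = S h.toNNReal y + ρ h := hS.mildConv_add hc hg hx.1 hh.le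
  have hn : ‖S h.toNNReal y‖ ^ 2 ≤ ‖y‖ ^ 2 := by
    have := hc h.toNNReal y
    gcongr
  rw [hflow, norm_add_sq_real, inner_smul_right, norm_smul, norm_inv, Real.norm_of_nonneg hh.le]
  have e1 : (2 * (h⁻¹ * ⟪S h.toNNReal y, ρ h⟫) + h * (h⁻¹ * ‖ρ h‖) ^ 2) * h
      = 2 * ⟪S h.toNNReal y, ρ h⟫ + ‖ρ h‖ ^ 2 := by
    field_simp
  rw [e1]
  linarith

theorem IsSemigroupOf.integrable_inner_mildConv (hS : IsSemigroupOf S A)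
    (hc : ∀ t x, ‖S t x‖ ≤ ‖x‖) (hf : Integrable f) (hg : Integrable g) :
    Integrable fun s => ⟪mildConv S f s, g s⟫ := by
  refine (hg.norm.const_mul (∫ s, ‖f s‖)).mono
    ((hS.continuous_mildConv hc hf).aestronglyMeasurable.inner hg.1)
    (Eventually.of_forall fun s => ?_)
  rw [norm_mul, norm_norm, Real.norm_of_nonneg (integral_nonneg fun _ => norm_nonneg _)]
  exact (norm_inner_le_norm _ _).trans (by gcongr; exact norm_mildConv_le hc hf s)

/-- The work `∫₀ᵗ ⟪y, g⟫` depends continuously on `g` in `L¹`. -/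
theorem IsSemigroupOf.abs_integral_inner_sub_le (hS : IsSemigroupOf S A)
    (hc : ∀ t x, ‖S t x‖ ≤ ‖x‖) (hf : Integrable f) (hg : Integrable g) (t : ℝ) :
    |(∫ s in (0 : ℝ)..t, ⟪mildConv S g s, g s⟫) - ∫ s in (0 : ℝ)..t, ⟪mildConv S f s, f s⟫|
      ≤ ((∫ s, ‖f s‖) + ∫ s, ‖g s‖) * ∫ s, ‖f s - g s‖ := by
  have hfg : Integrable fun s => f s - g s := hf.sub hg
  set M := ∫ s, ‖f s‖ with hM
  set N := ∫ s, ‖g s‖ with hN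
  set δ := ∫ s, ‖f s - g s‖ with hδ
  have hδ0 : 0 ≤ δ := integral_nonneg fun _ => norm_nonneg _
  have hN0 : 0 ≤ N := integral_nonneg fun _ => norm_nonneg _
  rw [← intervalIntegral.integral_sub
    (hS.integrable_inner_mildConv hc hg hg).intervalIntegrable
    (hS.integrable_inner_mildConv hc hf hf).intervalIntegrable, ← Real.norm_eq_abs]
  have hdom : Integrable fun s => N * ‖f s - g s‖ + δ * ‖f s‖ :=
    (hfg.norm.const_mul N).add (hf.norm.const_mul δ)
  have hpt : ∀ s, ‖⟪mildConv S g s, g s⟫ - ⟪mildConv S f s, f s⟫‖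
      ≤ N * ‖f s - g s‖ + δ * ‖f s‖ := by
    intro s
    have e : ⟪mildConv S g s, g s⟫ - ⟪mildConv S f s, f s⟫
        = -⟪mildConv S g s, f s - g s⟫ - ⟪mildConv S (fun s => f s - g s) s, f s⟫ := by
      rw [hS.mildConv_sub hc hf hg, inner_sub_left, inner_sub_right]; ring
    rw [e]
    refine (norm_sub_le _ _).trans ?_
    rw [norm_neg]
    refine add_le_add ((norm_inner_le_norm _ _).trans ?_) ((norm_inner_le_norm _ _).trans ?_)
    · gcongr; exact norm_mildConv_le hc hg s
    · gcongr; exact norm_mildConv_le hc hfg s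
  refine intervalIntegral.norm_integral_le_integral_norm_uIoc.trans ?_
  calc ∫ s in Set.uIoc 0 t, ‖⟪mildConv S g s, g s⟫ - ⟪mildConv S f s, f s⟫‖
      ≤ ∫ s in Set.uIoc 0 t, (N * ‖f s - g s‖ + δ * ‖f s‖) :=
        integral_mono_of_nonneg (Eventually.of_forall fun _ => norm_nonneg _)
          hdom.integrableOn (Eventually.of_forall hpt)
    _ ≤ ∫ s, (N * ‖f s - g s‖ + δ * ‖f s‖) :=
        setIntegral_le_integral hdom (Eventually.of_forall fun _ => by dsimp; positivity)
    _ = N * δ + δ * M := by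
        rw [integral_add (hfg.norm.const_mul N) (hf.norm.const_mul δ), integral_const_mul,
          integral_const_mul]
    _ = (M + N) * δ := by ring

/-- The energy inequality for the mild solution of `y' + A y = g` with `g` merely integrable, by
approximation in `L¹` by continuous functions. -/
theorem IsSemigroupOf.energy [CompleteSpace H] (hS : IsSemigroupOf S A)
    (hc : ∀ t x, ‖S t x‖ ≤ ‖x‖) (hg : Integrable g) {t : ℝ} (ht : 0 ≤ t) :
    ‖mildConv S g t‖ ^ 2 ≤ 2 * ∫ s in (0 : ℝ)..t, ⟪mildConv S g s, g s⟫ := by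
  have hex : ∀ n : ℕ, ∃ k : ℝ → H, Integrable k ∧ Continuous k ∧
      ∫ s, ‖g s - k s‖ ≤ 1 / ((n : ℝ) + 1) := fun n => by
    obtain ⟨k, -, h1, h2, h3⟩ := hg.exists_hasCompactSupport_integral_sub_le
      (Nat.one_div_pos_of_nat (α := ℝ) (n := n))
    exact ⟨k, h3, h2, h1⟩
  choose k hk hkc hkδ using hex
  set δ : ℕ → ℝ := fun n => ∫ s, ‖g s - k n s‖ with hδ
  have hδ0 : Tendsto δ atTop (𝓝 0) :=
    squeeze_zero (fun n => integral_nonneg fun _ => norm_nonneg _) hkδ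
      tendsto_one_div_add_atTop_nhds_zero_nat
  have hy : Tendsto (fun n => mildConv S (k n) t) atTop (𝓝 (mildConv S g t)) := by
    rw [tendsto_iff_norm_sub_tendsto_zero]
    refine squeeze_zero (fun _ => norm_nonneg _) (fun n => ?_) hδ0
    rw [norm_sub_rev, ← hS.mildConv_sub hc hg (hk n)]
    exact norm_mildConv_le hc (hg.sub (hk n)) t
  have hw : Tendsto (fun n => ∫ s in (0 : ℝ)..t, ⟪mildConv S (k n) s, k n s⟫) atTop
      (𝓝 (∫ s in (0 : ℝ)..t, ⟪mildConv S g s, g s⟫)) := by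
    rw [tendsto_iff_norm_sub_tendsto_zero]
    set M := ∫ s, ‖g s‖ with hM
    have hlim : Tendsto (fun n => (M + (M + δ n)) * δ n) atTop (𝓝 0) := by
      have := ((hδ0.const_add M).const_add M).mul hδ0
      simpa using this
    refine squeeze_zero (fun _ => norm_nonneg _) (fun n => ?_) hlim
    refine (hS.abs_integral_inner_sub_le hc hg (hk n) t).trans ?_
    have h1 : ∫ s, ‖k n s‖ ≤ M + δ n := by
      have h3 := integral_add hg.norm (hg.sub (hk n)).norm
      refine le_trans ?_ h3.le
      refine integral_mono (hk n).norm (hg.norm.add (hg.sub (hk n)).norm) fun s => ?_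
      exact norm_le_norm_add_norm_sub _ _
    have h2 : 0 ≤ δ n := integral_nonneg fun _ => norm_nonneg _
    gcongr
  refine le_of_tendsto_of_tendsto' (hy.norm.pow 2) (hw.const_mul 2) fun n => ?_
  have := hS.energy_of_continuous hc (hk n) (hkc n) ht
  rwa [intervalIntegral.integral_const_mul] at this

/-- Uniqueness for the deterministic equation: by the energy inequality, dissipativity up to `η`
of the forcing gives `‖y(t)‖² ≤ 2 |η| ∫₀ᵗ ‖y‖²`, and Gronwall's lemma applies. -/
theorem IsSemigroupOf.mildConv_eq_zero [CompleteSpace H] (hS : IsSemigroupOf S A)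
    (hc : ∀ t x, ‖S t x‖ ≤ ‖x‖) (hg : Integrable g) {T η : ℝ}
    (hη : ∀ᵐ s ∂(volume.restrict (Set.Icc 0 T)),
      ⟪mildConv S g s, g s⟫ ≤ η * ‖mildConv S g s‖ ^ 2) {t : ℝ} (ht : t ∈ Set.Icc 0 T) :
    mildConv S g t = 0 := by
  have hφ : Continuous fun s => ‖mildConv S g s‖ ^ 2 := (hS.continuous_mildConv hc hg).norm.pow 2
  set φ : ℝ → ℝ := fun s => ‖mildConv S g s‖ ^ 2 with hφd
  have hφ0 : ∀ s, 0 ≤ φ s := fun s => sq_nonneg _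
  set ψ : ℝ → ℝ := fun u => ∫ s in (0 : ℝ)..u, φ s with hψ
  have hψ0 : ∀ u, 0 ≤ u → 0 ≤ ψ u := fun u hu =>
    intervalIntegral.integral_nonneg hu fun s _ => hφ0 s
  have hder : ∀ b, HasDerivAt ψ (φ b) b := fun b => (hφ.integral_hasStrictDerivAt 0 b).hasDerivAt
  have hle : ∀ u ∈ Set.Icc 0 T, φ u ≤ 2 * |η| * ψ u := by
    intro u hu
    refine (hS.energy hc hg hu.1).trans ?_
    have hψη : |η| * ψ u = ∫ s in (0 : ℝ)..u, |η| * φ s :=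
      (intervalIntegral.integral_const_mul _ _).symm
    rw [mul_assoc, hψη]
    refine mul_le_mul_of_nonneg_left ?_ zero_le_two
    refine intervalIntegral.integral_mono_ae_restrict hu.1
      (hS.integrable_inner_mildConv hc hg hg).intervalIntegrable
      ((continuous_const.mul hφ).intervalIntegrable _ _) ?_
    filter_upwards [ae_restrict_of_ae_restrict_of_subset (Set.Icc_subset_Icc_right hu.2) hη]
      with s hs
    exact hs.trans (mul_le_mul_of_nonneg_right (le_abs_self η) (hφ0 s))
  have hG := norm_le_gronwallBound_of_norm_deriv_right_le (f := ψ) (f' := φ) (a := 0) (b := T)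
    (δ := 0) (K := 2 * |η|) (ε := 0)
    (fun b _ => (hder b).continuousAt.continuousWithinAt)
    (fun b _ => (hder b).hasDerivWithinAt) (by simp [hψ])
    (fun u hu => by
      rw [Real.norm_of_nonneg (hφ0 u), Real.norm_of_nonneg (hψ0 u hu.1), add_zero]
      exact hle u ⟨hu.1, hu.2.le⟩) t ht
  rw [gronwallBound_ε0_δ0] at hG
  have h1 : ψ t = 0 := norm_le_zero_iff.1 hG
  have h2 := hle t ht
  rw [h1, mul_zero] at h2
  have h3 : ‖mildConv S g t‖ ^ 2 = 0 := le_antisymm h2 (hφ0 t)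
  exact norm_eq_zero.1 (pow_eq_zero_iff two_ne_zero |>.1 h3)

end Convolution

/-! ### Transfer between the half-line and the real line -/

theorem map_leb_restrict_Iic (t : ℝ≥0) :
    (leb.restrict (Set.Iic t)).map ((↑) : ℝ≥0 → ℝ) = volume.restrict (Set.Icc 0 (t : ℝ)) := by
  have he : MeasurableEmbedding ((↑) : ℝ≥0 → ℝ) := .subtype_coe measurableSet_Ici
  have h1 : Set.Iic t = ((↑) : ℝ≥0 → ℝ) ⁻¹' Set.Iic (t : ℝ) := by ext; simp
  rw [h1, ← he.restrict_map, leb, he.map_comap, Measure.restrict_restrict measurableSet_Iic,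
    NNReal.range_coe]
  congr 1
  ext; simp [and_comm]

theorem ae_restrict_leb_iff {t : ℝ≥0} {p : ℝ≥0 → Prop} :
    (∀ᵐ s ∂(leb.restrict (Set.Iic t)), p s) ↔
      ∀ᵐ s ∂(volume.restrict (Set.Icc 0 (t : ℝ))), p s.toNNReal := by
  have he : MeasurableEmbedding ((↑) : ℝ≥0 → ℝ) := .subtype_coe measurableSet_Ici
  rw [← map_leb_restrict_Iic, he.ae_map_iff]
  simp

theorem integrable_indicator_toNNReal {E : Type*} [NormedAddCommGroup E] {T : ℝ≥0} {f : ℝ≥0 → E}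
    (hf : IntegrableOn f (Set.Iic T) leb) :
    Integrable ((Set.Icc 0 (T : ℝ)).indicator fun s => f s.toNNReal) := by
  have he : MeasurableEmbedding ((↑) : ℝ≥0 → ℝ) := .subtype_coe measurableSet_Ici
  rw [integrable_indicator_iff measurableSet_Icc, IntegrableOn, ← map_leb_restrict_Iic,
    he.integrable_map_iff]
  simpa [Function.comp_def, IntegrableOn] using hf

variable {H : Type*} [NormedAddCommGroup H] [InnerProductSpace ℝ H]

theorem setIntegral_leb_eq_mildConv (S : ℝ≥0 → H →L[ℝ] H) (f : ℝ≥0 → H) {t T : ℝ≥0}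
    (ht : t ≤ T) :
    ∫ s in Set.Iic t, S (t - s) (f s) ∂leb =
      mildConv S ((Set.Icc 0 (T : ℝ)).indicator fun s => f s.toNNReal) t := by
  have he : MeasurableEmbedding ((↑) : ℝ≥0 → ℝ) := .subtype_coe measurableSet_Ici
  have h1 : ∫ s in Set.Iic t, S (t - s) (f s) ∂leb =
      ∫ s in Set.Icc 0 (t : ℝ), S ((t : ℝ) - s).toNNReal (f s.toNNReal) := by
    rw [← map_leb_restrict_Iic, he.integral_map]
    simp [NNReal.sub_def]
  rw [h1, mildConv, intervalIntegral.integral_of_le (NNReal.coe_nonneg t),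
    integral_Icc_eq_integral_Ioc]
  refine setIntegral_congr_fun measurableSet_Ioc fun s hs => ?_
  have : s ∈ Set.Icc 0 (T : ℝ) := ⟨hs.1.le, hs.2.trans (by exact_mod_cast ht)⟩
  simp only [Set.indicator_of_mem this]

/-! ### Uniqueness of the stochastic integrals -/

section Stochastic

variable {Ω : Type*} [mΩ : MeasurableSpace Ω] {P : Measure Ω} {𝓕 : Filtration ℝ≥0 mΩ}

theorem IsWienerIntegral.ae_eq {K : Type*} [NormedAddCommGroup K] [InnerProductSpace ℝ K]
    {R : K →L[ℝ] K} {W : ℝ≥0 → Ω → K} {Φ : ℝ≥0 → Ω → R.toLinearMap.range →ₗ[ℝ] H} {t : ℝ≥0}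
    {X Y : Ω → H} (hX : IsWienerIntegral P 𝓕 R W Φ t X) (hY : IsWienerIntegral P 𝓕 R W Φ t Y) :
    X =ᵐ[P] Y := by
  obtain ⟨φ, hφ⟩ := hX.1
  exact tendstoInMeasure_ae_unique (hX.2 φ hφ) (hY.2 φ hφ)

theorem IsPoissonIntegral.ae_eq {Z : Type*} [MeasurableSpace Z] {m : Measure Z}
    {μ : Ω → Measure (ℝ≥0 × Z)} {g : ℝ≥0 → Ω → Z → H} {t : ℝ≥0} {X Y : Ω → H}
    (hX : IsPoissonIntegral P 𝓕 m μ g t X) (hY : IsPoissonIntegral P 𝓕 m μ g t Y) :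
    X =ᵐ[P] Y := by
  obtain ⟨φ, hφ⟩ := hX.1
  exact tendstoInMeasure_ae_unique (hX.2 φ hφ) (hY.2 φ hφ)

/-- At each fixed time the left-hand sides of the mild equations of two solutions agree almost
surely; the noise no longer appears. -/
theorem IsMildSolution.ae_add_eq {T : ℝ≥0} {K : Type*} [NormedAddCommGroup K]
    [InnerProductSpace ℝ K] {R : K →L[ℝ] K} {W : ℝ≥0 → Ω → K} {Z : Type*} [MeasurableSpace Z]
    {m : Measure Z} {μ : Ω → Measure (ℝ≥0 × Z)} {S : ℝ≥0 → H →L[ℝ] H} {D : Set H} {F : H → H}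
    {B : ℝ≥0 → Ω → R.toLinearMap.range →ₗ[ℝ] H} {G : ℝ≥0 → Ω → Z → H} {u₀ : Ω → H}
    {u v : ℝ≥0 → Ω → H} (hu : IsMildSolution P 𝓕 T R W m μ S D F B G u₀ u)
    (hv : IsMildSolution P 𝓕 T R W m μ S D F B G u₀ v) {t : ℝ≥0} (ht : t ≤ T) :
    ∀ᵐ ω ∂P, u t ω + ∫ s in Set.Iic t, S (t - s) (F (u s ω)) ∂leb =
      v t ω + ∫ s in Set.Iic t, S (t - s) (F (v s ω)) ∂leb := by
  obtain ⟨I, J, hI, hJ, h⟩ := hu.equation t ht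
  obtain ⟨I', J', hI', hJ', h'⟩ := hv.equation t ht
  filter_upwards [h, h', hI.ae_eq hI', hJ.ae_eq hJ'] with ω h1 h2 h3 h4
  rw [h1, h2, h3, h4]

/-! ### From fixed times to almost all times -/

/-- If a pathwise continuous process `y` is a version of a jointly measurable process `w`, then
almost surely the two agree at almost all times. On a complete space `y` is measurable at each
time, hence jointly measurable after discarding a null set, so Fubini's theorem applies. -/
theorem ae_ae_eq_of_continuous {E : Type*} [NormedAddCommGroup E]
    [TopologicalSpace.SeparableSpace E] [SFinite P] [P.IsComplete]
    {y w : ℝ → Ω → E} (hy : ∀ᵐ ω ∂P, Continuous fun r => y r ω)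
    (hw : StronglyMeasurable (Function.uncurry w)) (h : ∀ r, y r =ᵐ[P] w r) :
    ∀ᵐ ω ∂P, ∀ᵐ r : ℝ, y r ω = w r ω := by
  borelize E
  have : SecondCountableTopology E := UniformSpace.secondCountable_of_separable E
  set y' : ℝ → Ω → E := fun r => {ω | Continuous fun r => y r ω}.indicator (y r) with hy'
  have hyy' : ∀ᵐ ω ∂P, ∀ r, y' r ω = y r ω := by
    filter_upwards [hy] with ω hω r
    exact Set.indicator_of_mem (s := {ω | Continuous fun r => y r ω}) hω (y r)
  have hcont : ∀ ω, Continuous fun r => y' r ω := by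
    intro ω
    by_cases hω : ω ∈ {ω | Continuous fun r => y r ω}
    · simp only [hy', Set.indicator_of_mem hω]
      exact hω
    · simpa only [hy', Set.indicator_of_notMem hω] using continuous_const
  have hae : ∀ r, y' r =ᵐ[P] w r := fun r => by
    filter_upwards [hyy', h r] with ω h1 h2
    rw [h1, h2]
  have hmeas : ∀ r, StronglyMeasurable (y' r) := fun r => by
    have h1 : StronglyMeasurable (w r) := hw.comp_measurable measurable_prodMk_left
    have h2 : AEMeasurable (y' r) P := h1.aestronglyMeasurable.aemeasurable.congr (hae r).symm
    exact (aemeasurable_iff_measurable.1 h2).stronglyMeasurable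
  have hjoint := stronglyMeasurable_uncurry_of_continuous_of_stronglyMeasurable hcont hmeas
  have hset : MeasurableSet {p : ℝ × Ω | y' p.1 p.2 = w p.1 p.2} :=
    hjoint.measurableSet_eq_fun hw
  have := (Measure.ae_ae_comm (μ := (volume : Measure ℝ)) (ν := P) hset).1
    (Eventually.of_forall hae)
  filter_upwards [this, hyy'] with ω h1 h2
  filter_upwards [h1] with r hr
  rw [← h2, hr]

end Stochastic

end MildEq

/-! ### Uniqueness of mild solutions -/

theorem theorem3p1
    -- the stochastic basis
    {Ω : Type*} [mΩ : MeasurableSpace Ω] (P : Measure Ω) [IsProbabilityMeasure P]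
    (𝓕 : Filtration ℝ≥0 mΩ) (T : ℝ≥0) (hT : 0 < T) (h𝓕 : MildEq.UsualConditions P 𝓕 T)
    {K : Type*} [NormedAddCommGroup K] [InnerProductSpace ℝ K] [CompleteSpace K]
    [TopologicalSpace.SeparableSpace K]
    {H : Type*} [NormedAddCommGroup H] [InnerProductSpace ℝ H] [CompleteSpace H]
    [TopologicalSpace.SeparableSpace H]
    -- the Wiener process with covariance `Q`, and `R = Q^{1/2}`
    (Q R : K →L[ℝ] K) (hR : R.IsPositive) (hRQ : R.comp R = Q)
    (W : ℝ≥0 → Ω → K) (hW : MildEq.IsWienerProc P 𝓕 T Q W)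
    -- the Poisson measure with compensator `Leb ⊗ m`
    {Z : Type*} [MeasurableSpace Z] (m : Measure Z) [SigmaFinite m]
    (μ : Ω → Measure (ℝ≥0 × Z)) (hμ : MildEq.IsPoissonRandomMeasure P 𝓕 T m μ)
    -- the linear monotone operator `A` and the semigroup `S t = e^{-tA}`
    (A : H →ₗ.[ℝ] H) (hA : ∀ x : A.domain, 0 ≤ ⟪A x, (x : H)⟫)
    (S : ℝ≥0 → H →L[ℝ] H) (hS : MildEq.IsSemigroupOf S A)
    -- the nonlinear operator `F` with domain `D`, such that `F + η I` is monotone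
    (D : Set H) (F : H → H) (η : ℝ)
    (hF : ∀ x ∈ D, ∀ y ∈ D, 0 ≤ ⟪(F x + η • x) - (F y + η • y), x - y⟫)
    -- the coefficients of the noise
    (B : ℝ≥0 → Ω → R.toLinearMap.range →ₗ[ℝ] H)
    (hB : ∀ k : K, IsStronglyProgressive 𝓕
      (fun t ω => if t ≤ T then B t ω (R.toLinearMap.rangeRestrict k) else 0))
    (G : ℝ≥0 → Ω → Z → H)
    (hG : StronglyMeasurable[MeasurableSpace.prod 𝓕.predictable inferInstance]
      (fun p : (ℝ≥0 × Ω) × Z => if p.1.1 ≤ T then G p.1.1 p.1.2 p.2 else 0))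
    (hBG : ∀ t ≤ T, ∀ᵐ ω ∂P,
      (∀ᵐ s ∂(MildEq.leb.restrict (Set.Iic t)),
        MildEq.qNormSq R ((S (t - s)).toLinearMap ∘ₗ B s ω) < ∞) ∧
      ∫⁻ s in Set.Iic t, (MildEq.qNormSq R ((S (t - s)).toLinearMap ∘ₗ B s ω)
        + ∫⁻ z, ‖S (t - s) (G s ω z)‖ₑ ^ 2 ∂m) ∂MildEq.leb < ∞)
    -- two mild solutions with the same initial condition
    (u₀ : Ω → H) (u v : ℝ≥0 → Ω → H)
    (hu : MildEq.IsMildSolution P 𝓕 T R W m μ S D F B G u₀ u)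
    (hv : MildEq.IsMildSolution P 𝓕 T R W m μ S D F B G u₀ v)
    (huF : ∀ᵐ ω ∂P, IntegrableOn (fun s => F (u s ω)) (Set.Iic T) MildEq.leb)
    (hvF : ∀ᵐ ω ∂P, IntegrableOn (fun s => F (v s ω)) (Set.Iic T) MildEq.leb) :
    (∀ t ≤ T, ∀ᵐ ω ∂P, u t ω = v t ω) ∧
    -- if the two equations hold for all `t` outside one null set, with one common version `C` of
    -- the right-hand side, then the solutions are indistinguishable
    ((∃ C : ℝ≥0 → Ω → H,
        (∀ᵐ ω ∂P, ∀ t ≤ T,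
          u t ω + ∫ s in Set.Iic t, S (t - s) (F (u s ω)) ∂MildEq.leb = C t ω) ∧
        (∀ᵐ ω ∂P, ∀ t ≤ T,
          v t ω + ∫ s in Set.Iic t, S (t - s) (F (v s ω)) ∂MildEq.leb = C t ω)) →
      ∀ᵐ ω ∂P, ∀ t ≤ T, u t ω = v t ω) := by
  have hc := hS.norm_le hA
  have : P.IsComplete := ⟨fun N hN => 𝓕.le 0 N (h𝓕.null_sets N hN)⟩
  -- the forcing of the equation for `u - v`, extended by zero to the real line
  set g : Ω → ℝ → H := fun ω =>
    (Set.Icc 0 (T : ℝ)).indicator fun s => F (v s.toNNReal ω) - F (u s.toNNReal ω) with hg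
  have hgint : ∀ᵐ ω ∂P, Integrable (g ω) := by
    filter_upwards [huF, hvF] with ω h1 h2
    exact MildEq.integrable_indicator_toNNReal (h2.sub h1)
  have hconv : ∀ᵐ ω ∂P, ∀ t ≤ T, MildEq.mildConv S (g ω) t =
      (∫ s in Set.Iic t, S (t - s) (F (v s ω)) ∂MildEq.leb) -
        ∫ s in Set.Iic t, S (t - s) (F (u s ω)) ∂MildEq.leb := by
    filter_upwards [huF, hvF] with ω h1 h2 t ht
    rw [MildEq.setIntegral_leb_eq_mildConv S (fun s => F (v s ω)) ht,
      MildEq.setIntegral_leb_eq_mildConv S (fun s => F (u s ω)) ht,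
      ← hS.mildConv_sub hc (MildEq.integrable_indicator_toNNReal h2)
        (MildEq.integrable_indicator_toNNReal h1)]
    congr 1
    exact Set.indicator_sub (Set.Icc 0 (T : ℝ)) (fun s : ℝ => F (v s.toNNReal ω))
      (fun s : ℝ => F (u s.toNNReal ω))
  have hfix : ∀ t ≤ T, ∀ᵐ ω ∂P, MildEq.mildConv S (g ω) t = u t ω - v t ω := by
    intro t ht
    filter_upwards [hconv, hu.ae_add_eq hv ht] with ω h1 h2
    rw [h1 t ht, sub_eq_sub_iff_add_eq_add, add_comm, ← h2, add_comm]
  -- Processes on `[0, T]` become processes on `ℝ` by stopping time at `0` and at `T`.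
  -- `F` is not assumed measurable, so the joint measurability of the convolution comes only from
  -- its continuity in time and its agreement with `u - v` at fixed times.
  have hcl : ∀ r : ℝ, min r.toNNReal T ≤ T := fun r => min_le_right _ _
  have hmeas : StronglyMeasurable (Function.uncurry fun (r : ℝ) (ω : Ω) =>
      u (min r.toNNReal T) ω - v (min r.toNNReal T) ω) := by
    have hm : Measurable fun p : ℝ × Ω =>
        ((⟨min p.1.toNNReal T, hcl p.1⟩ : Set.Iic T), p.2) :=
      (Measurable.subtype_mk ((measurable_real_toNNReal.comp measurable_fst).min
        measurable_const)).prodMk measurable_snd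
    exact (hu.measurable.comp_measurable hm).sub (hv.measurable.comp_measurable hm)
  have haa : ∀ᵐ ω ∂P, ∀ᵐ r : ℝ, MildEq.mildConv S (g ω) (min r.toNNReal T : ℝ≥0) =
      u (min r.toNNReal T) ω - v (min r.toNNReal T) ω := by
    refine MildEq.ae_ae_eq_of_continuous ?_ hmeas fun r => hfix _ (hcl r)
    filter_upwards [hgint] with ω hω
    exact (hS.continuous_mildConv hc hω).comp
      (NNReal.continuous_coe.comp (continuous_real_toNNReal.min continuous_const))
  have hzero : ∀ᵐ ω ∂P, ∀ t ≤ T, MildEq.mildConv S (g ω) (t : ℝ≥0) = 0 := by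
    filter_upwards [hgint, haa, hu.mem_domain, hv.mem_domain] with ω hω hωa huD hvD t ht
    refine hS.mildConv_eq_zero hc hω (T := T) (η := η) ?_ ⟨t.2, by exact_mod_cast ht⟩
    filter_upwards [MildEq.ae_restrict_leb_iff.1 huD, MildEq.ae_restrict_leb_iff.1 hvD,
      ae_restrict_of_ae hωa, ae_restrict_mem measurableSet_Icc] with s hsu hsv hs hsT
    rw [min_eq_left (Real.toNNReal_le_iff_le_coe.2 hsT.2), Real.coe_toNNReal _ hsT.1] at hs
    have h1 := hF _ hsu _ hsv
    rw [hs, hg]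
    simp only [Set.indicator_of_mem hsT]
    have h2 : ⟪(F (u s.toNNReal ω) + η • u s.toNNReal ω) -
          (F (v s.toNNReal ω) + η • v s.toNNReal ω), u s.toNNReal ω - v s.toNNReal ω⟫
        = η * ‖u s.toNNReal ω - v s.toNNReal ω‖ ^ 2 - ⟪u s.toNNReal ω - v s.toNNReal ω,
          F (v s.toNNReal ω) - F (u s.toNNReal ω)⟫ := by
      rw [← real_inner_self_eq_norm_sq, ← real_inner_smul_left,
        real_inner_comm (F (v s.toNNReal ω) - F (u s.toNNReal ω)), ← inner_sub_left]
      congr 1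
      rw [smul_sub]; abel
    linarith
  refine ⟨fun t ht => ?_, ?_⟩
  · filter_upwards [hzero, hfix t ht] with ω h1 h2
    rw [h1 t ht] at h2
    exact sub_eq_zero.1 h2.symm
  · rintro ⟨C, hCu, hCv⟩
    filter_upwards [hzero, hconv, hCu, hCv] with ω h1 h2 h3 h4 t ht
    have h5 := h2 t ht
    rw [h1 t ht] at h5
    have h6 := (h3 t ht).trans (h4 t ht).symm
    rw [sub_eq_zero.1 h5.symm] at h6
    exact add_right_cancel h6
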